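/- For $n\in\mathbb{N}$ and $x\in\mathbb{R}$ let $He_n(x)=\mathbb{E}_{Z\sim\mathcal N(0,1)}[(x+iZ)^n]$ be the probabilist's Hermite polynomial (a real number), and let $$\mathrm{Ai}(u)=\frac{1}{2\pi i}\int_{\langle}\exp\Big(\frac{t^3}{3}-ut\Big)\,dt$$ be the Airy function, where $\langle$ is the contour that runs from $\infty e^{-i\pi/3}$ along a ray to $0$ and from there along a ray to $\infty e^{i\pi/3}$. All limits below are for $n\to\infty$ with the other parameters fixed, and $f(n)=g(n)(1+o(1))$ means $f(n)/g(n)\to 1$. 1. (Small $x$.) For every $a\in(0,1)$, $$He_n(2a\sqrt n)=n^{n/2}\,\frac{\sqrt2}{(1-a^2)^{1/4}}\,e^{n(a^2-1/2)}\Big(\cos\theta_n+o(1)\Big),\qquad \theta_n=n\big(a\sqrt{1-a^2}-\arccos a\big)-\tfrac12\big(\arccos a-\tfrac{\pi}{2}\big).$$ Equivalently, for every $\alpha\in(0,\pi/2)$, $$He_n(2\cos(\alpha)\sqrt n)=n^{n/2}\sqrt{\frac{2}{\sin\alpha}}\;e^{n(\cos^2\alpha-1/2)}\Big(\cos\theta_n+o(1)\Big),\qquad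 \theta_n=n(\sin\alpha\cos\alpha-\alpha)-\tfrac12\big(\alpha-\tfrac{\pi}{2}\big).$$ In both forms, for every $\delta>0$, as $n\to\infty$ through those $n$ with $|\cos\theta_n|\ge\delta$ one may replace the factor $(\cos\theta_n+o(1))$ by $\cos\theta_n\,(1+o(1))$. 2. (Large $x$.) For every $a>1$, written as $a=\cosh\gamma$ with $\gamma\ge0$, $$He_n(2a\sqrt n)=n^{n/2}\,e^{n(\gamma+\frac12e^{-2\gamma})}\,\frac{e^{\gamma/2}}{\sqrt{2\sinh\gamma}}\,(1+o(1)).$$ 3. (Edge.) For every $u\in\mathbb{R}$, $$He_n(2\sqrt n+n^{-1/6}u)=\sqrt{2\pi}\,e^{n/2}\,n^{n/2}\,n^{1/6}\,e^{un^{1/3}}\big(\mathrm{Ai}(u)+o(1)\big),$$ and, if $\mathrm{Ai}(u)\ne0$, the last factor may be replaced by $\mathrm{Ai}(u)(1+o(1))$. -/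

import Mathlib

open Filter Topology MeasureTheory ProbabilityTheory

/-- The Gaussian expectation `𝔼[(x + iZ)^n]`, `Z ~ N(0,1)`, which defines the probabilist's Hermite
polynomial. Its value is real for real `x`, see `ofReal_hermiteHe`. -/
noncomputable def hermiteExpectation (n : ℕ) (x : ℝ) : ℂ :=
  ∫ z : ℝ, ((x : ℂ) + Complex.I * (z : ℂ)) ^ n ∂(gaussianReal 0 1)

/-- The probabilist's Hermite polynomial `He_n(x) = 𝔼[(x + iZ)^n]` as a real number. -/
noncomputable def hermiteHe (n : ℕ) (x : ℝ) : ℝ := (hermiteExpectation n x).re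

/-- The Gaussian expectation is real, so that taking the real part loses nothing. -/
theorem ofReal_hermiteHe (n : ℕ) (x : ℝ) : (hermiteHe n x : ℂ) = hermiteExpectation n x := by
  refine Complex.conj_eq_iff_re.mp ?_
  have h : (gaussianReal 0 1).map (fun z : ℝ => -z) = gaussianReal 0 1 := by
    rw [gaussianReal_map_neg, neg_zero]
  have h2 : hermiteExpectation n x
      = ∫ z : ℝ, ((x : ℂ) + Complex.I * ((-z : ℝ) : ℂ)) ^ n ∂(gaussianReal 0 1) := by
    unfold hermiteExpectation
    conv_lhs => rw [← h]
    rw [integral_map (by fun_prop) (by fun_prop)]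
  conv_rhs => rw [h2]
  unfold hermiteExpectation
  rw [← integral_conj]
  congr 1
  funext z
  simp

/-- The integrand of the Airy integral along the ray `{t e^{iφ} : t ≥ 0}`, parametrised by `t`
(with `dw = e^{iφ} dt`). -/
noncomputable def airyRayIntegrand (φ : ℝ) (u : ℂ) (t : ℝ) : ℂ :=
  Complex.exp (((t : ℂ) * Complex.exp (φ * Complex.I)) ^ 3 / 3
    - u * ((t : ℂ) * Complex.exp (φ * Complex.I))) * Complex.exp (φ * Complex.I)

/-- The Airy function `Ai(u) = (2πi)⁻¹ ∫ exp(w³/3 - u w) dw` on `ℂ`, the contour being the two rays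
from the origin at angles `±π/3`, run through from `∞ e^{-iπ/3}` to `0` to `∞ e^{iπ/3}`. -/
noncomputable def airyC (u : ℂ) : ℂ :=
  1 / (2 * (Real.pi : ℂ) * Complex.I) *
    ((∫ t in Set.Ioi (0 : ℝ), airyRayIntegrand (Real.pi / 3) u t)
      - ∫ t in Set.Ioi (0 : ℝ), airyRayIntegrand (-(Real.pi / 3)) u t)

/-- The Airy function on the real line, where it is real-valued, see `ofReal_airyAi`. -/
noncomputable def airyAi (u : ℝ) : ℝ := (airyC u).re

/-- The Airy function is real on the real line, so that taking the real part loses nothing. -/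
theorem ofReal_airyAi (u : ℝ) : (airyAi u : ℂ) = airyC u := by
  refine Complex.conj_eq_iff_re.mp ?_
  have h : ∀ φ : ℝ, (starRingEnd ℂ) (∫ t in Set.Ioi (0 : ℝ), airyRayIntegrand φ u t)
      = ∫ t in Set.Ioi (0 : ℝ), airyRayIntegrand (-φ) u t := by
    intro φ
    rw [← integral_conj]
    congr 1
    funext t
    simp [airyRayIntegrand, ← Complex.exp_conj, map_ofNat (starRingEnd ℂ) 3]
  unfold airyC
  rw [map_mul, map_sub, h, h, neg_neg]
  simp only [map_div₀, map_mul, map_one, Complex.conj_I, Complex.conj_ofReal, map_ofNat]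
  rw [mul_neg, div_neg]
  ring

/-- The phase of the oscillating factor for `x = 2 cos(α) √n`. -/
noncomputable def oscPhase (n : ℕ) (α : ℝ) : ℝ :=
  n * (Real.sin α * Real.cos α - α) - 1 / 2 * (α - Real.pi / 2)

/-- The amplitude of the oscillating factor for `x = 2 cos(α) √n`. -/
noncomputable def oscAmplitude (n : ℕ) (α : ℝ) : ℝ :=
  (n : ℝ) ^ ((n : ℝ) / 2) * Real.sqrt (2 / Real.sin α) *
    Real.exp (n * (Real.cos α ^ 2 - 1 / 2))

/-- The same phase for `x = 2 a √n`, written in terms of `a = cos(α)`. -/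
noncomputable def oscPhaseArccos (n : ℕ) (a : ℝ) : ℝ :=
  n * (a * Real.sqrt (1 - a ^ 2) - Real.arccos a) - 1 / 2 * (Real.arccos a - Real.pi / 2)

/-- The same amplitude for `x = 2 a √n`, written in terms of `a = cos(α)`. -/
noncomputable def oscAmplitudeArccos (n : ℕ) (a : ℝ) : ℝ :=
  (n : ℝ) ^ ((n : ℝ) / 2) * (Real.sqrt 2 / (1 - a ^ 2) ^ (1 / 4 : ℝ)) *
    Real.exp (n * (a ^ 2 - 1 / 2))

/-- The approximation for `x = 2 cosh(γ) √n`. -/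
noncomputable def largeApprox (n : ℕ) (γ : ℝ) : ℝ :=
  (n : ℝ) ^ ((n : ℝ) / 2) * Real.exp (n * (γ + 1 / 2 * Real.exp (-2 * γ))) *
    (Real.exp (γ / 2) / Real.sqrt (2 * Real.sinh γ))

/-- The factor in front of `Ai(u)` for `x = 2 √n + n^{-1/6} u`. -/
noncomputable def edgeFactor (n : ℕ) (u : ℝ) : ℝ :=
  Real.sqrt (2 * Real.pi) * Real.exp ((n : ℝ) / 2) * (n : ℝ) ^ ((n : ℝ) / 2) *
    (n : ℝ) ^ (1 / 6 : ℝ) * Real.exp (u * (n : ℝ) ^ (1 / 3 : ℝ))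

/-! The proof is the saddle point method. On the line `Re w = x` the Gaussian expectation is
`(2π)^(-1/2) ∫ w^n exp((w - x)²/2) dv`, `w = x + iv`, and the line may be moved to any other
abscissa (`integral_hermiteKernel`). Scaling `w` and `x = X√n` by `√n` turns the integrand into
`exp(n φ(w))` with `φ(w) = log w + (w - X)²/2`, whose saddles solve `X = w + w⁻¹`.

For `X = 2 cosh γ` the line goes through the outer real saddle `e^γ`. For `X = 2 cos α` it goes
through both saddles `e^{±iα}`; they contribute complex conjugates, so twice the real part of the
upper half gives the cosine. In both cases the fluctuation on scale `n^{-1/2}` is Gaussian with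
coefficient `φ''(w₀) = 1 - w₀⁻²` (`tendsto_saddleKernel`). At `X = 2` the saddles merge at `1`, the
cubic term dominates on scale `n^{-1/3}`, and the limit is the Airy integral over a vertical line
(`tendsto_edgeKernel`, `integral_airyKernel_line`).

Each limit is dominated convergence, so what carries the proof are Gaussian bounds uniform in `n`:
`norm_saddleKernel_le`, `norm_saddleKernel_exp_le` and `norm_edgeKernel_le`. -/

/-! ### Integral representation over vertical lines -/

/-- The integrand `w^n exp((w - x)²/2)`, whose integral over any vertical line is a multiple of
`He_n(x)`. -/
noncomputable def hermiteKernel (n : ℕ) (x : ℝ) (w : ℂ) : ℂ := w ^ n * Complex.exp ((w - x) ^ 2 / 2)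

theorem continuous_hermiteKernel (n : ℕ) (x : ℝ) : Continuous (hermiteKernel n x) := by
  unfold hermiteKernel
  fun_prop

theorem norm_cexp_sq_div_two (x c v : ℝ) :
    ‖Complex.exp (((c : ℂ) + v * Complex.I - x) ^ 2 / 2)‖ = Real.exp (((c - x) ^ 2 - v ^ 2) / 2) := by
  rw [Complex.norm_exp]
  congr 1
  have : ((c : ℂ) + v * Complex.I - x) ^ 2 / 2
      = ((((c - x) ^ 2 - v ^ 2) / 2 : ℝ) : ℂ) + (((c - x) * v : ℝ) : ℂ) * Complex.I := by
    push_cast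
    linear_combination ((v : ℂ) ^ 2 / 2) * Complex.I_sq
  rw [this, Complex.add_re, Complex.ofReal_re, Complex.re_ofReal_mul, Complex.I_re, mul_zero,
    add_zero]

theorem norm_hermiteKernel_le (n : ℕ) (x c v : ℝ) :
    ‖hermiteKernel n x (c + v * Complex.I)‖
      ≤ n.factorial * Real.exp (|c| + 1 + (c - x) ^ 2 / 2) * Real.exp (-(1 / 4) * v ^ 2) := by
  unfold hermiteKernel
  rw [norm_mul, norm_pow, norm_cexp_sq_div_two]
  set r := ‖(c : ℂ) + v * Complex.I‖
  have hr : r ≤ |c| + |v| := by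
    refine (norm_add_le _ _).trans ?_
    simp
  have h1 : r ^ n ≤ n.factorial * Real.exp (|c| + |v|) := by
    have := Real.pow_div_factorial_le_exp r (norm_nonneg _) n
    rw [div_le_iff₀ (by positivity), mul_comm] at this
    refine this.trans ?_
    gcongr
  refine (mul_le_mul_of_nonneg_right h1 (Real.exp_pos _).le).trans ?_
  rw [mul_assoc, mul_assoc, ← Real.exp_add, ← Real.exp_add]
  refine mul_le_mul_of_nonneg_left (Real.exp_le_exp.2 ?_) (Nat.cast_nonneg _)
  -- `(|v| - 2)² ≥ 0` says `|v| - v²/2 ≤ 1 - v²/4`: half of the Gaussian rate pays for the factor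
  -- `exp |v|`.
  nlinarith [sq_nonneg (|v| - 2), sq_abs v]

theorem integrable_hermiteKernel (n : ℕ) (x c : ℝ) :
    Integrable (fun v : ℝ => hermiteKernel n x (c + v * Complex.I)) := by
  refine Integrable.mono' ((integrable_exp_neg_mul_sq (b := 1 / 4) (by norm_num)).const_mul
    (n.factorial * Real.exp (|c| + 1 + (c - x) ^ 2 / 2))) ?_ ?_
  · exact ((continuous_hermiteKernel n x).comp (by fun_prop)).aestronglyMeasurable
  · exact Eventually.of_forall fun v => norm_hermiteKernel_le n x c v

theorem hasDerivAt_hermiteKernel (n : ℕ) (x : ℝ) (w : ℂ) :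
    HasDerivAt (hermiteKernel n x)
      (n * hermiteKernel (n - 1) x w + (hermiteKernel (n + 1) x w - x * hermiteKernel n x w)) w := by
  have h2 : HasDerivAt (fun w : ℂ => (w - x) ^ 2 / 2) (w - x) w := by
    have := (((hasDerivAt_id w).sub_const (x : ℂ)).pow 2).div_const 2
    refine this.congr_deriv ?_
    simp
  have := (hasDerivAt_pow n w).mul h2.cexp
  refine this.congr_deriv ?_
  simp only [hermiteKernel]
  ring

/-- The derivative of an integrable function along the line integrates to zero. This is the Hermite
recursion, with coefficients free of `c`. For `n = 0` the truncated index `n - 1` is harmless, its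
coefficient being zero. -/
theorem integral_hermiteKernel_rec (n : ℕ) (x c : ℝ) :
    ∫ v : ℝ, hermiteKernel (n + 1) x (c + v * Complex.I)
      = x * (∫ v : ℝ, hermiteKernel n x (c + v * Complex.I))
        - n * ∫ v : ℝ, hermiteKernel (n - 1) x (c + v * Complex.I) := by
  have hi := fun m => integrable_hermiteKernel m x c
  have hl : ∀ v : ℝ, HasDerivAt (fun v : ℝ => (c : ℂ) + v * Complex.I) Complex.I v := fun v => by
    simpa using ((Complex.ofRealCLM.hasDerivAt (x := v)).mul_const Complex.I).const_add (c : ℂ)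
  have hsub : Integrable (fun v : ℝ => hermiteKernel (n + 1) x (c + v * Complex.I)
      - x * hermiteKernel n x (c + v * Complex.I)) := (hi _).sub ((hi _).const_mul _)
  have hint : Integrable (fun v : ℝ => (n * hermiteKernel (n - 1) x (c + v * Complex.I)
      + (hermiteKernel (n + 1) x (c + v * Complex.I) - x * hermiteKernel n x (c + v * Complex.I)))) :=
    ((hi _).const_mul _).add hsub
  have h0 := integral_eq_zero_of_hasDerivAt_of_integrable
    (fun v : ℝ => (hasDerivAt_hermiteKernel n x _).comp v (hl v)) (hint.mul_const _) (hi n)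
  rw [integral_mul_const, integral_add ((hi _).const_mul _) hsub,
    integral_sub (hi _) ((hi _).const_mul _), integral_const_mul, integral_const_mul] at h0
  have h1 := (mul_eq_zero.mp h0).resolve_right Complex.I_ne_zero
  linear_combination h1

theorem integral_hermiteKernel_zero (x c : ℝ) :
    ∫ v : ℝ, hermiteKernel 0 x (c + v * Complex.I) = ((Real.pi : ℂ) / (1 / 2)) ^ (1 / 2 : ℂ) := by
  rw [← GaussianFourier.integral_cexp_neg_mul_sq_add_real_mul_I (b := 1 / 2) (by norm_num) (x - c)]
  congr 1
  funext v
  simp only [hermiteKernel, pow_zero, one_mul]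
  congr 1
  push_cast
  linear_combination ((v : ℂ) ^ 2 / 2 + (x - c) ^ 2 / 2) * Complex.I_sq

/-- The integral over a vertical line does not depend on the line. -/
theorem integral_hermiteKernel_eq (n : ℕ) (x c d : ℝ) :
    ∫ v : ℝ, hermiteKernel n x (c + v * Complex.I)
      = ∫ v : ℝ, hermiteKernel n x (d + v * Complex.I) := by
  -- No contour is shifted: the recursion and the Gaussian integral at `n = 0` are both free of the
  -- abscissa.
  induction n using Nat.strong_induction_on with
  | _ n ih =>
    rcases n with _ | n
    · rw [integral_hermiteKernel_zero, integral_hermiteKernel_zero]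
    · rw [integral_hermiteKernel_rec, integral_hermiteKernel_rec, ih n (by omega),
        ih (n - 1) (by omega)]

/-- On the line through `x` the exponential factor is `√(2π)` times the standard Gaussian density.
-/
theorem integral_hermiteKernel (n : ℕ) (x c : ℝ) :
    ∫ v : ℝ, hermiteKernel n x (c + v * Complex.I) = √(2 * Real.pi) * (hermiteHe n x : ℂ) := by
  rw [integral_hermiteKernel_eq n x c x, ofReal_hermiteHe, hermiteExpectation,
    integral_gaussianReal_eq_integral_smul one_ne_zero, ← integral_const_mul]
  congr 1
  funext v
  have h : ((√(2 * Real.pi) : ℝ) : ℂ) ≠ 0 := by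
    rw [Complex.ofReal_ne_zero]
    positivity
  simp only [hermiteKernel, gaussianPDFReal, Complex.real_smul, NNReal.coe_one, mul_one, sub_zero,
    Complex.ofReal_mul, Complex.ofReal_inv, Complex.ofReal_exp]
  have h2 : ((x : ℂ) + v * Complex.I - x) ^ 2 / 2 = ((-v ^ 2 / 2 : ℝ) : ℂ) := by
    push_cast
    linear_combination ((v : ℂ) ^ 2 / 2) * Complex.I_sq
  rw [h2, mul_comm Complex.I]
  push_cast
  field_simp

/-! ### Rescaling by `√n` -/

theorem ofReal_sqrt_natCast_sq (n : ℕ) : ((√n : ℝ) : ℂ) ^ 2 = n := by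
  rw [← Complex.ofReal_pow, Real.sq_sqrt (by positivity)]
  simp

theorem ofReal_sqrt_natCast_ne_zero {n : ℕ} (hn : 0 < n) : ((√n : ℝ) : ℂ) ≠ 0 := by
  rw [Complex.ofReal_ne_zero]
  positivity

theorem hermiteKernel_scaled {n : ℕ} (hn : 0 < n) (X : ℝ) (w₀ : ℂ) (y : ℝ) :
    hermiteKernel n (X * √n)
        (((√n * w₀.re : ℝ) : ℂ) + ((y + √n * w₀.im : ℝ) : ℂ) * Complex.I)
      = (√n : ℂ) ^ n * ((w₀ + y / √n * Complex.I) ^ n *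
          Complex.exp (n * (w₀ + y / √n * Complex.I - X) ^ 2 / 2)) := by
  have hs := ofReal_sqrt_natCast_ne_zero hn
  have hw : ((√n * w₀.re : ℝ) : ℂ) + ((y + √n * w₀.im : ℝ) : ℂ) * Complex.I
      = √n * (w₀ + y / √n * Complex.I) := by
    conv_rhs => rw [← Complex.re_add_im w₀]
    push_cast
    field_simp
    ring
  rw [hw, hermiteKernel, mul_pow, mul_assoc]
  congr 3
  push_cast
  rw [← ofReal_sqrt_natCast_sq n]
  ring

/-- The rescaled integral representation, centred at an arbitrary point `w₀`. -/
theorem integral_scaled_hermite {n : ℕ} (hn : 0 < n) (X : ℝ) (w₀ : ℂ) :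
    √(2 * Real.pi) * (hermiteHe n (X * √n) : ℂ)
      = (√n : ℂ) ^ n * ∫ y : ℝ, (w₀ + y / √n * Complex.I) ^ n *
          Complex.exp (n * (w₀ + y / √n * Complex.I - X) ^ 2 / 2) := by
  rw [← integral_hermiteKernel n _ (√n * w₀.re), ← integral_const_mul,
    ← integral_add_right_eq_self _ (√n * w₀.im)]
  congr 1
  funext y
  exact hermiteKernel_scaled hn X w₀ y

theorem hermiteKernel_conj (n : ℕ) (x : ℝ) (w : ℂ) :
    hermiteKernel n x (starRingEnd ℂ w) = starRingEnd ℂ (hermiteKernel n x w) := by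
  simp [hermiteKernel, ← Complex.exp_conj, map_ofNat (starRingEnd ℂ) 2]

/-- The upper half of the vertical line suffices, the lower half contributes the conjugate. -/
theorem integral_hermiteKernel_eq_two_mul_re (n : ℕ) (x c : ℝ) :
    ∫ v : ℝ, hermiteKernel n x (c + v * Complex.I)
      = 2 * ((∫ v in Set.Ioi (0 : ℝ), hermiteKernel n x (c + v * Complex.I)).re : ℂ) := by
  rw [← integral_add_compl (measurableSet_Ioi (a := (0 : ℝ))) (integrable_hermiteKernel n x c),
    Set.compl_Ioi, ← neg_zero, ← integral_comp_neg_Ioi, neg_zero, ← Complex.ofReal_ofNat,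
    ← Complex.ofReal_mul, ← Complex.add_conj, ← integral_conj]
  congr 2
  funext v
  rw [← hermiteKernel_conj]
  simp

/-- The half line `v > 0` becomes `y > -√n Im w₀`, which varies with `n`; the indicator keeps the
domain fixed for dominated convergence. -/
theorem scaled_hermite_eq_two_mul_re {n : ℕ} (hn : 0 < n) (X : ℝ) (w₀ : ℂ) :
    √(2 * Real.pi) * hermiteHe n (X * √n)
      = 2 * ((√n : ℂ) ^ n * ∫ y : ℝ, (Set.Ioi (-(√n * w₀.im))).indicator
          (fun y : ℝ => (w₀ + y / √n * Complex.I) ^ n *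
            Complex.exp (n * (w₀ + y / √n * Complex.I - X) ^ 2 / 2)) y).re := by
  have h := integral_hermiteKernel n (X * √n) (√n * w₀.re)
  rw [integral_hermiteKernel_eq_two_mul_re] at h
  have h' : √(2 * Real.pi) * hermiteHe n (X * √n) = 2 * (∫ v in Set.Ioi (0 : ℝ),
      hermiteKernel n (X * √n) ((√n * w₀.re : ℝ) + v * Complex.I)).re := by
    exact_mod_cast h.symm
  rw [h', ← integral_indicator measurableSet_Ioi, ← integral_add_right_eq_self _ (√n * w₀.im),
    ← integral_const_mul]
  congr 3
  funext y
  have hmem : y + √n * w₀.im ∈ Set.Ioi (0 : ℝ) ↔ y ∈ Set.Ioi (-(√n * w₀.im)) := by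
    simp [neg_lt_iff_pos_add]
  by_cases hy : y ∈ Set.Ioi (-(√n * w₀.im))
  · rw [Set.indicator_of_mem hy, Set.indicator_of_mem (hmem.2 hy), hermiteKernel_scaled hn]
  · rw [Set.indicator_of_notMem hy, Set.indicator_of_notMem (mt hmem.1 hy), mul_zero]

/-! ### Expansion and domination at a saddle point -/

theorem norm_log_one_add_sub_le {w : ℂ} (hw : ‖w‖ ≤ 1 / 2) :
    ‖Complex.log (1 + w) - w + w ^ 2 / 2‖ ≤ ‖w‖ ^ 3 := by
  have h := Complex.norm_log_sub_logTaylor_le 2 (lt_of_le_of_lt hw (by norm_num))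
  have e : Complex.logTaylor (2 + 1) w = w - w ^ 2 / 2 := by
    simp [Complex.logTaylor_succ, Complex.logTaylor_zero]
    ring
  rw [e] at h
  have h2 : (1 - ‖w‖)⁻¹ ≤ 2 := by
    rw [inv_le_comm₀ (by linarith) (by norm_num)]
    linarith
  calc _ = ‖Complex.log (1 + w) - (w - w ^ 2 / 2)‖ := by ring_nf
    _ ≤ _ := h
    _ ≤ ‖w‖ ^ (2 + 1) * 2 / ((2 : ℕ) + 1) := by gcongr
    _ ≤ ‖w‖ ^ 3 := by
      have := pow_nonneg (norm_nonneg w) 3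
      norm_num
      linarith

/-- One order more than `norm_log_one_add_sub_le`, for the double saddle, where the cubic term
survives. -/
theorem norm_log_one_add_sub_le' {w : ℂ} (hw : ‖w‖ ≤ 1 / 2) :
    ‖Complex.log (1 + w) - w + w ^ 2 / 2 - w ^ 3 / 3‖ ≤ ‖w‖ ^ 4 := by
  have h := Complex.norm_log_sub_logTaylor_le 3 (lt_of_le_of_lt hw (by norm_num))
  have e : Complex.logTaylor (3 + 1) w = w - w ^ 2 / 2 + w ^ 3 / 3 := by
    simp [Complex.logTaylor_succ, Complex.logTaylor_zero]
    ring
  rw [e] at h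
  have h2 : (1 - ‖w‖)⁻¹ ≤ 2 := by
    rw [inv_le_comm₀ (by linarith) (by norm_num)]
    linarith
  calc _ = ‖Complex.log (1 + w) - (w - w ^ 2 / 2 + w ^ 3 / 3)‖ := by ring_nf
    _ ≤ _ := h
    _ ≤ ‖w‖ ^ (3 + 1) * 2 / ((3 : ℕ) + 1) := by gcongr
    _ ≤ ‖w‖ ^ 4 := by
      have := pow_nonneg (norm_nonneg w) 4
      norm_num
      linarith

theorem tendsto_sqrt_natCast_atTop : Tendsto (fun n : ℕ => √(n : ℝ)) atTop atTop :=
  Real.tendsto_sqrt_atTop.comp tendsto_natCast_atTop_atTop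

/-- The integrand of the scaled representation, normalised by its value at the saddle point `w₀`
of `log w + (w - w₀ - w₀⁻¹)² / 2`. -/
noncomputable def saddleKernel (n : ℕ) (w₀ : ℂ) (y : ℝ) : ℂ :=
  (1 + y / √n * Complex.I / w₀) ^ n *
    Complex.exp (-(n * (y / √n * Complex.I / w₀)) - (y : ℂ) ^ 2 / 2)

theorem continuous_saddleKernel (n : ℕ) (w₀ : ℂ) : Continuous (saddleKernel n w₀) := by
  unfold saddleKernel
  fun_prop

/-- `hX` is the saddle equation: the cross term of the square is then `-n z` with `z = (iy/√n)/w₀`,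
which cancels the linear part of `n log(1 + z)`. -/
theorem scaled_eq_saddleKernel {n : ℕ} (hn : 0 < n) {w₀ : ℂ} (h₀ : w₀ ≠ 0) {X : ℝ}
    (hX : (X : ℂ) = w₀ + w₀⁻¹) (y : ℝ) :
    (w₀ + y / √n * Complex.I) ^ n * Complex.exp (n * (w₀ + y / √n * Complex.I - X) ^ 2 / 2)
      = w₀ ^ n * Complex.exp (n * w₀⁻¹ ^ 2 / 2) * saddleKernel n w₀ y := by
  have hs := ofReal_sqrt_natCast_ne_zero hn
  have h1 : w₀ + y / √n * Complex.I = w₀ * (1 + y / √n * Complex.I / w₀) := by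
    field_simp
  have h2 : (n : ℂ) * (w₀ + y / √n * Complex.I - X) ^ 2 / 2
      = n * w₀⁻¹ ^ 2 / 2 + (-(n * (y / √n * Complex.I / w₀)) - (y : ℂ) ^ 2 / 2) := by
    rw [hX, ← ofReal_sqrt_natCast_sq n]
    field_simp
    linear_combination (w₀ ^ 2 * (y : ℂ) ^ 2) * Complex.I_sq
  rw [h2, h1, mul_pow, Complex.exp_add, saddleKernel]
  ring

/-- With `z = ζ/√n`, `n (log(1 + z) - z)` tends to `-ζ²/2 = y²/(2 w₀²)`, with an error of at most `n
|z|³ = |ζ|³/√n`. -/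
theorem tendsto_saddleKernel (w₀ : ℂ) (y : ℝ) :
    Tendsto (fun n : ℕ => saddleKernel n w₀ y) atTop
      (𝓝 (Complex.exp (-((1 - w₀⁻¹ ^ 2) / 2) * (y : ℂ) ^ 2))) := by
  set ζ : ℂ := y * Complex.I / w₀ with hζ
  have hlim : Tendsto (fun n : ℕ => ‖ζ‖ / √n) atTop (𝓝 0) :=
    tendsto_sqrt_natCast_atTop.const_div_atTop _
  have hz : ∀ n : ℕ, (y / √n * Complex.I / w₀ : ℂ) = ζ / √n := fun n => by
    rw [hζ]; ring
  have hnorm : ∀ n : ℕ, ‖(ζ / √n : ℂ)‖ = ‖ζ‖ / √n := fun n => by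
    rw [norm_div, Complex.norm_real, Real.norm_of_nonneg (Real.sqrt_nonneg _)]
  have hev : ∀ᶠ n : ℕ in atTop, 0 < n ∧ ‖ζ‖ / √n ≤ 1 / 2 :=
    (eventually_gt_atTop 0).and (hlim.eventually_le_const (by norm_num))
  have hmain : Tendsto (fun n : ℕ => (n : ℂ) * (Complex.log (1 + ζ / √n) - ζ / √n + (ζ / √n) ^ 2 / 2))
      atTop (𝓝 0) := by
    refine squeeze_zero_norm' (a := fun n : ℕ => ‖ζ‖ ^ 2 * (‖ζ‖ / √n)) ?_
      (by simpa using hlim.const_mul (‖ζ‖ ^ 2))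
    filter_upwards [hev] with n hn
    have hb := norm_log_one_add_sub_le ((hnorm n).trans_le hn.2)
    rw [hnorm] at hb
    rw [norm_mul, Complex.norm_natCast]
    have hs : (0 : ℝ) < √n := by have := hn.1; positivity
    calc _ ≤ (n : ℝ) * (‖ζ‖ / √n) ^ 3 := by gcongr
      _ = √n ^ 2 * (‖ζ‖ / √n) ^ 3 := by rw [Real.sq_sqrt (Nat.cast_nonneg _)]
      _ = _ := by field_simp
  have hexp := (Complex.continuous_exp.tendsto _).comp
    (hmain.add_const (-((1 - w₀⁻¹ ^ 2) / 2) * (y : ℂ) ^ 2))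
  rw [zero_add] at hexp
  refine hexp.congr' ?_
  filter_upwards [hev] with n hn
  have hs := ofReal_sqrt_natCast_ne_zero hn.1
  have h1 : (1 + ζ / √n : ℂ) ≠ 0 := by
    intro h
    have h2 : ‖(ζ / √n : ℂ)‖ = 1 := by
      rw [eq_neg_of_add_eq_zero_right h]; simp
    rw [hnorm] at h2
    linarith [hn.2]
  rw [saddleKernel, hz, Function.comp_apply]
  conv_rhs => rw [← Complex.exp_log h1, ← Complex.exp_nat_mul, ← Complex.exp_add]
  congr 1
  have h3 : (n : ℂ) * (ζ / √n) ^ 2 = -(w₀⁻¹ ^ 2 * y ^ 2) := by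
    rw [← ofReal_sqrt_natCast_sq n, hζ]
    field_simp
    linear_combination (w₀⁻¹ ^ 2 * (y : ℂ) ^ 2) * Complex.I_sq
  linear_combination h3 / 2

theorem norm_saddleKernel (n : ℕ) (w₀ : ℂ) (y : ℝ) :
    ‖saddleKernel n w₀ y‖ = ‖1 + y / √n * Complex.I / w₀‖ ^ n *
      Real.exp (-(n * (y / √n * Complex.I / w₀ : ℂ).re) - y ^ 2 / 2) := by
  rw [saddleKernel, norm_mul, norm_pow, Complex.norm_exp]
  congr 2
  have h : (y : ℂ) ^ 2 / 2 = ((y ^ 2 / 2 : ℝ) : ℂ) := by push_cast; rfl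
  rw [h, Complex.sub_re, Complex.neg_re, ← Complex.ofReal_natCast, Complex.re_ofReal_mul,
    Complex.ofReal_re]

theorem norm_one_add_sq (z : ℂ) : ‖1 + z‖ ^ 2 = 1 + 2 * z.re + ‖z‖ ^ 2 := by
  rw [← Complex.normSq_eq_norm_sq, ← Complex.normSq_eq_norm_sq, Complex.normSq_apply,
    Complex.normSq_apply]
  simp
  ring

theorem norm_saddle_step_sq {n : ℕ} (hn : 0 < n) (w₀ : ℂ) (y : ℝ) :
    n * ‖(y / √n * Complex.I / w₀ : ℂ)‖ ^ 2 = y ^ 2 * ‖w₀‖⁻¹ ^ 2 := by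
  have hs : (0 : ℝ) < √n := by positivity
  rw [norm_div, norm_mul, norm_div, Complex.norm_I, Complex.norm_real, Complex.norm_real,
    Real.norm_eq_abs, Real.norm_of_nonneg hs.le, div_pow, mul_pow, div_pow, sq_abs,
    Real.sq_sqrt (Nat.cast_nonneg _)]
  have : (n : ℝ) ≠ 0 := by positivity
  field_simp

/-- From `|1 + z|² = 1 + 2 Re z + |z|² ≤ exp(2 Re z + |z|²)`; the terms in `Re z` cancel. The bound
decays only if `|w₀| > 1`, so a saddle on the unit circle needs a finer one. -/
theorem norm_saddleKernel_le {n : ℕ} (hn : 0 < n) (w₀ : ℂ) (y : ℝ) :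
    ‖saddleKernel n w₀ y‖ ≤ Real.exp (-((1 - ‖w₀‖⁻¹ ^ 2) / 2) * y ^ 2) := by
  rw [norm_saddleKernel]
  have hstep := norm_saddle_step_sq hn w₀ y
  set z : ℂ := y / √n * Complex.I / w₀
  have h1 : ‖1 + z‖ ≤ Real.exp (z.re + ‖z‖ ^ 2 / 2) := by
    refine le_of_sq_le_sq ?_ (Real.exp_pos _).le
    rw [norm_one_add_sq, ← Real.exp_nat_mul]
    refine le_trans (le_of_eq ?_) (Real.add_one_le_exp _)
    push_cast
    ring
  calc _ ≤ Real.exp (z.re + ‖z‖ ^ 2 / 2) ^ n * Real.exp (-(n * z.re) - y ^ 2 / 2) := by gcongr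
    _ = _ := by
      rw [← Real.exp_nat_mul, ← Real.exp_add]
      congr 1
      linear_combination hstep / 2

/-- On the upper half plane the kernel at a saddle point of modulus one is dominated by a
Gaussian. -/
theorem norm_saddleKernel_exp_le {n : ℕ} (hn : 0 < n) {α : ℝ} (hs : 0 < Real.sin α)
    (hc : 0 < Real.cos α) {y : ℝ} (hy : -(√n * Real.sin α) < y) :
    ‖saddleKernel n (Complex.exp (α * Complex.I)) y‖
      ≤ Real.exp (-(Real.sin α ^ 2 / 8) * y ^ 2) := by
  have hn' : (0 : ℝ) < √n := by positivity
  have hn2 : √(n : ℝ) ^ 2 = n := Real.sq_sqrt (Nat.cast_nonneg _)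
  rw [norm_saddleKernel]
  have hstep := norm_saddle_step_sq hn (Complex.exp (α * Complex.I)) y
  rw [Complex.norm_exp_ofReal_mul_I, inv_one, one_pow, mul_one] at hstep
  set z : ℂ := y / √n * Complex.I / Complex.exp (α * Complex.I) with hz
  set s := Real.sin α
  set c := Real.cos α
  have hcs : s ^ 2 + c ^ 2 = 1 := Real.sin_sq_add_cos_sq α
  set δ := y / √n with hδ
  set r := ‖1 + z‖ with hr
  have hr0 : 0 ≤ r := norm_nonneg _
  have hv : 0 < s + δ := by
    rw [hδ]
    have : 0 < (√n * s + y) / √n := by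
      apply div_pos _ hn'
      linarith
    rwa [add_div, mul_div_cancel_left₀ _ hn'.ne'] at this
  have hyδ : y = √n * δ := by
    rw [hδ]; field_simp
  have hre : z.re = δ * s := by
    have : z = δ * Complex.I * Complex.exp ((-α : ℝ) * Complex.I) := by
      rw [hz, hδ, div_eq_mul_inv _ (Complex.exp _), ← Complex.exp_neg]
      push_cast
      ring_nf
    rw [this, Complex.exp_mul_I, ← Complex.ofReal_cos, ← Complex.ofReal_sin, Real.cos_neg,
      Real.sin_neg]
    simp [s, Complex.sin_ofReal_re]
  have hzn : ‖z‖ ^ 2 = δ ^ 2 := by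
    have h0 : (n : ℝ) ≠ 0 := by positivity
    apply mul_left_cancel₀ h0
    rw [hstep, hyδ, mul_pow, hn2]
  have hr2 : r ^ 2 = 1 + 2 * (δ * s) + δ ^ 2 := by
    rw [hr, norm_one_add_sq, hre, hzn]
  -- `r` is the modulus of `c + i(s + δ)`, at most the sum of its two positive coordinates.
  have hrle : r ≤ c + (s + δ) := by
    refine le_of_sq_le_sq ?_ (by positivity)
    rw [hr2]
    nlinarith [mul_pos hc hv]
  have hs1 : s ≤ 1 := Real.sin_le_one α
  have hc1 : c ≤ 1 := Real.cos_le_one α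
  -- Since `r² - 1 = δ(2s + δ)`, it suffices that `s/2 (r + 1) ≤ 2s + δ`, which follows from `hrle`
  -- and `s, c ≤ 1`. Here the upper half plane is needed: `s + δ > 0`.
  have hkey : (s / 2 * δ) ^ 2 ≤ (r - 1) ^ 2 := by
    rw [sq_le_sq, abs_mul, abs_of_pos (half_pos hs)]
    have hprod : |r - 1| * (r + 1) = |δ| * (2 * s + δ) := by
      have e : (r - 1) * (r + 1) = δ * (2 * s + δ) := by linear_combination hr2
      have := congrArg abs e
      rwa [abs_mul, abs_mul, abs_of_pos (by positivity : 0 < r + 1),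
        abs_of_pos (by linarith : 0 < 2 * s + δ)] at this
    have h2 : s / 2 * |δ| * (r + 1) ≤ |r - 1| * (r + 1) := by
      rw [hprod]
      have : s / 2 * (r + 1) ≤ 2 * s + δ := by nlinarith
      nlinarith [abs_nonneg δ]
    exact le_of_mul_le_mul_right h2 (by positivity)
  -- The exponent depends on `r` alone: `n(log r - (r² - 1)/2) ≤ -n(r - 1)²/2`. With `hkey` this
  -- gives the rate `s²/8`.
  have hrexp : r ≤ Real.exp (r - 1) := by linarith [Real.add_one_le_exp (r - 1)]
  calc r ^ n * Real.exp (-(n * z.re) - y ^ 2 / 2)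
      ≤ Real.exp (r - 1) ^ n * Real.exp (-(n * z.re) - y ^ 2 / 2) := by gcongr
    _ = Real.exp (-(n * (r - 1) ^ 2 / 2)) := by
      rw [← Real.exp_nat_mul, ← Real.exp_add, hre, hyδ, mul_pow, hn2]
      congr 1
      linear_combination (n : ℝ) / 2 * hr2
    _ ≤ _ := by
      refine Real.exp_le_exp.2 ?_
      rw [hyδ, mul_pow, hn2]
      nlinarith [mul_le_mul_of_nonneg_left hkey (Nat.cast_nonneg (α := ℝ) n)]

theorem sqrt_natCast_pow (n : ℕ) : √(n : ℝ) ^ n = (n : ℝ) ^ ((n : ℝ) / 2) := by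
  rw [Real.sqrt_eq_rpow, ← Real.rpow_natCast, ← Real.rpow_mul (Nat.cast_nonneg _)]
  congr 1
  ring

theorem tendsto_div_mul_one {ι : Type*} {l : Filter ι} {f g : ι → ℝ} {δ : ℝ} (hδ : 0 < δ)
    (h : Tendsto (fun n => f n - g n) l (𝓝 0)) (hg : ∀ᶠ n in l, δ ≤ |g n|) :
    Tendsto (fun n => f n / g n) l (𝓝 1) := by
  rw [tendsto_iff_norm_sub_tendsto_zero]
  have h0 : Tendsto (fun n => |f n - g n| / δ) l (𝓝 0) := by
    simpa using (h.abs).div_const δ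
  refine squeeze_zero' (Eventually.of_forall fun _ => norm_nonneg _) ?_ h0
  filter_upwards [hg] with n hn
  have hgn : g n ≠ 0 := by
    intro h
    rw [h, abs_zero] at hn
    linarith
  have : f n / g n - 1 = (f n - g n) / g n := by field_simp
  rw [this, Real.norm_eq_abs, abs_div]
  gcongr

/-! ### Large arguments -/

theorem tendsto_integral_saddleKernel {w₀ : ℂ} (h : 1 < ‖w₀‖) :
    Tendsto (fun n : ℕ => ∫ y : ℝ, saddleKernel n w₀ y) atTop
      (𝓝 (((Real.pi : ℂ) / ((1 - w₀⁻¹ ^ 2) / 2)) ^ (1 / 2 : ℂ))) := by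
  have hlt : ‖w₀‖⁻¹ ^ 2 < 1 := by
    have : ‖w₀‖⁻¹ < 1 := inv_lt_one_of_one_lt₀ h
    exact pow_lt_one₀ (by positivity) this (by norm_num)
  have hre : 0 < ((1 - w₀⁻¹ ^ 2) / 2).re := by
    have h1 := Complex.re_le_norm (w₀⁻¹ ^ 2)
    rw [norm_pow, norm_inv] at h1
    have : ((1 - w₀⁻¹ ^ 2) / 2).re = (1 - (w₀⁻¹ ^ 2).re) / 2 := by
      rw [← Complex.ofReal_ofNat, Complex.div_ofReal_re]
      simp
    rw [this]
    linarith
  rw [← integral_gaussian_complex hre]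
  refine tendsto_integral_filter_of_dominated_convergence
    (fun y => Real.exp (-((1 - ‖w₀‖⁻¹ ^ 2) / 2) * y ^ 2)) ?_ ?_
    (integrable_exp_neg_mul_sq (by linarith)) ?_
  · exact Eventually.of_forall fun n => (continuous_saddleKernel n w₀).aestronglyMeasurable
  · filter_upwards [eventually_gt_atTop 0] with n hn
    exact Eventually.of_forall fun y => norm_saddleKernel_le hn w₀ y
  · exact Eventually.of_forall fun y => tendsto_saddleKernel w₀ y

/-- The line passes through the saddle `e^γ`, the one outside the unit circle, where
`norm_saddleKernel_le` gives a decaying bound. -/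
theorem tendsto_hermiteHe_large {γ : ℝ} (hγ : 0 < γ) :
    Tendsto (fun n : ℕ => hermiteHe n (2 * Real.cosh γ * √n) / largeApprox n γ) atTop (𝓝 1) := by
  have hsinh : 0 < Real.sinh γ := Real.sinh_pos_iff.2 hγ
  set b : ℝ := (1 - Real.exp (-2 * γ)) / 2 with hb
  have hb' : b = Real.exp (-γ) * Real.sinh γ := by
    rw [hb, Real.sinh_eq, show -2 * γ = -γ + -γ by ring, Real.exp_add, Real.exp_neg]
    have := Real.exp_pos γ
    field_simp
  have hb0 : 0 < b := by rw [hb']; positivity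
  set w₀ : ℂ := ((Real.exp γ : ℝ) : ℂ) with hw
  have h₀ : w₀ ≠ 0 := by rw [hw, Complex.ofReal_ne_zero]; positivity
  have hnorm : 1 < ‖w₀‖ := by
    rw [hw, Complex.norm_real, Real.norm_of_nonneg (Real.exp_pos _).le]
    exact Real.one_lt_exp_iff.2 hγ
  have hinv : w₀⁻¹ ^ 2 = ((Real.exp (-2 * γ) : ℝ) : ℂ) := by
    rw [hw, ← Complex.ofReal_inv, ← Complex.ofReal_pow, ← Real.exp_neg, ← Real.exp_nat_mul]
    norm_num
  have hX : ((2 * Real.cosh γ : ℝ) : ℂ) = w₀ + w₀⁻¹ := by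
    rw [hw, ← Complex.ofReal_inv, ← Complex.ofReal_add, ← Real.exp_neg, Real.cosh_eq]
    congr 1
    ring
  have hJ := tendsto_integral_saddleKernel hnorm
  have hval : ((Real.pi : ℂ) / ((1 - w₀⁻¹ ^ 2) / 2)) ^ (1 / 2 : ℂ) = ((√(Real.pi / b) : ℝ) : ℂ) := by
    rw [Real.sqrt_eq_rpow, Complex.ofReal_cpow (by positivity), hinv, hb]
    push_cast
    rfl
  rw [hval] at hJ
  have hconst : √(Real.pi / b) = √(2 * Real.pi) * (Real.exp (γ / 2) / √(2 * Real.sinh γ)) := by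
    rw [Real.exp_half, ← Real.sqrt_div (Real.exp_pos _).le, ← Real.sqrt_mul (by positivity), hb',
      Real.exp_neg]
    congr 1
    have := Real.exp_pos γ
    field_simp
  set K := √(2 * Real.pi) * (Real.exp (γ / 2) / √(2 * Real.sinh γ)) with hK
  have hK0 : 0 < K := by positivity
  have hlim := (Complex.continuous_re.tendsto _).comp hJ
  rw [Complex.ofReal_re, hconst] at hlim
  have hlim' := hlim.div_const K
  rw [div_self hK0.ne'] at hlim'
  refine hlim'.congr' ?_
  filter_upwards [eventually_gt_atTop 0] with n hn
  have hI := integral_scaled_hermite hn (2 * Real.cosh γ) w₀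
  simp only [scaled_eq_saddleKernel hn h₀ hX] at hI
  rw [integral_const_mul] at hI
  set J := ∫ y : ℝ, saddleKernel n w₀ y
  have hpre : ((√n : ℝ) : ℂ) ^ n * (w₀ ^ n * Complex.exp (n * w₀⁻¹ ^ 2 / 2))
      = (((n : ℝ) ^ ((n : ℝ) / 2) * Real.exp (n * (γ + 1 / 2 * Real.exp (-2 * γ))) : ℝ) : ℂ) := by
    rw [hinv, hw, ← sqrt_natCast_pow, mul_add, Real.exp_add, Real.exp_nat_mul]
    push_cast
    congr 4
    ring
  rw [← mul_assoc, hpre, ← Complex.ofReal_mul] at hI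
  have hI' := congrArg Complex.re hI
  rw [Complex.ofReal_re, Complex.re_ofReal_mul] at hI'
  have hn' : (0 : ℝ) < n := by exact_mod_cast hn
  rw [Function.comp_apply, largeApprox, hK]
  have h2 : (0 : ℝ) < √(2 * Real.pi) := by positivity
  rw [div_eq_div_iff (by positivity) (by positivity)]
  linear_combination (-(Real.exp (γ / 2) / √(2 * Real.sinh γ))) * hI'

/-! ### Small arguments -/

/-- The polar form shows that the real part is positive, and its argument `π/2 - α` becomes the
phase `(α - π/2)/2` after the inverse square root. -/
theorem saddle_modulus_one_coeff (α : ℝ) :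
    (1 - (Complex.exp (α * Complex.I))⁻¹ ^ 2) / 2
      = Real.sin α * Complex.exp (((Real.pi / 2 - α : ℝ) : ℂ) * Complex.I) := by
  have h : Complex.exp (((Real.pi / 2 - α : ℝ) : ℂ) * Complex.I)
      = Complex.I * (Complex.exp (α * Complex.I))⁻¹ := by
    have e : ((Real.pi / 2 - α : ℝ) : ℂ) * Complex.I
        = Real.pi / 2 * Complex.I + -(α * Complex.I) := by
      push_cast
      ring
    rw [e, Complex.exp_add, Complex.exp_pi_div_two_mul_I, Complex.exp_neg]
  rw [h, Complex.ofReal_sin, Complex.sin, neg_mul, Complex.exp_neg]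
  have := Complex.exp_ne_zero (α * Complex.I)
  field_simp
  linear_combination (Complex.exp (α * Complex.I) ^ 2 - 1) * Complex.I_sq

theorem tendsto_integral_indicator_saddleKernel {α : ℝ} (h0 : 0 < α) (h1 : α < Real.pi / 2) :
    Tendsto (fun n : ℕ => ∫ y : ℝ, (Set.Ioi (-(√n * Real.sin α))).indicator
        (saddleKernel n (Complex.exp (α * Complex.I))) y) atTop
      (𝓝 (√(Real.pi / Real.sin α) * Complex.exp (((α - Real.pi / 2) / 2 : ℝ) * Complex.I))) := by
  have hs : 0 < Real.sin α := Real.sin_pos_of_pos_of_lt_pi h0 (by linarith [Real.pi_pos])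
  have hc : 0 < Real.cos α := Real.cos_pos_of_mem_Ioo ⟨by linarith [Real.pi_pos], h1⟩
  have hcoeff := saddle_modulus_one_coeff α
  have hre : 0 < ((1 - (Complex.exp (α * Complex.I))⁻¹ ^ 2) / 2).re := by
    rw [hcoeff, Complex.re_ofReal_mul, Complex.exp_ofReal_mul_I_re, Real.cos_pi_div_two_sub]
    positivity
  have hval : (√(Real.pi / Real.sin α) * Complex.exp (((α - Real.pi / 2) / 2 : ℝ) * Complex.I))
      = ((Real.pi : ℂ) / ((1 - (Complex.exp (α * Complex.I))⁻¹ ^ 2) / 2)) ^ (1 / 2 : ℂ) := by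
    -- The principal root is the one with positive real part; the cosine of the half angle is
    -- positive.
    rw [one_div, ← Complex.sq_cpow_two_inv (x := √(Real.pi / Real.sin α) *
      Complex.exp (((α - Real.pi / 2) / 2 : ℝ) * Complex.I)), hcoeff, mul_pow, ← Complex.ofReal_pow,
      Real.sq_sqrt (by positivity), ← Complex.exp_nat_mul]
    · congr 1
      have e : ((2 : ℕ) : ℂ) * ((((α - Real.pi / 2) / 2 : ℝ) : ℂ) * Complex.I)
          = -(((Real.pi / 2 - α : ℝ) : ℂ) * Complex.I) := by
        push_cast
        ring
      rw [e, Complex.exp_neg]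
      push_cast
      field_simp
    · rw [Complex.re_ofReal_mul, Complex.exp_ofReal_mul_I_re]
      have : 0 < Real.cos ((α - Real.pi / 2) / 2) :=
        Real.cos_pos_of_mem_Ioo ⟨by linarith [Real.pi_pos], by linarith [Real.pi_pos]⟩
      positivity
  rw [hval, ← integral_gaussian_complex hre]
  refine tendsto_integral_filter_of_dominated_convergence
    (fun y => Real.exp (-(Real.sin α ^ 2 / 8) * y ^ 2)) ?_ ?_
    (integrable_exp_neg_mul_sq (by positivity)) ?_
  · exact Eventually.of_forall fun n =>
      (continuous_saddleKernel n _).aestronglyMeasurable.indicator measurableSet_Ioi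
  · filter_upwards [eventually_gt_atTop 0] with n hn
    refine Eventually.of_forall fun y => ?_
    by_cases hy : y ∈ Set.Ioi (-(√n * Real.sin α))
    · rw [Set.indicator_of_mem hy]
      exact norm_saddleKernel_exp_le hn hs hc hy
    · rw [Set.indicator_of_notMem hy, norm_zero]
      positivity
  · refine Eventually.of_forall fun y => (tendsto_saddleKernel _ y).congr' ?_
    have ht : Tendsto (fun n : ℕ => √(n : ℝ) * Real.sin α) atTop atTop :=
      tendsto_sqrt_natCast_atTop.atTop_mul_const hs
    filter_upwards [ht.eventually_gt_atTop (-y)] with n hn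
    rw [Set.indicator_of_mem]
    simp only [Set.mem_Ioi]
    linarith

theorem oscAmplitude_pos {n : ℕ} (hn : 0 < n) {α : ℝ} (hs : 0 < Real.sin α) :
    0 < oscAmplitude n α := by
  unfold oscAmplitude
  have hn' : (0 : ℝ) < n := by exact_mod_cast hn
  positivity

theorem hermiteHe_div_oscAmplitude {n : ℕ} (hn : 0 < n) {α : ℝ} (hs : 0 < Real.sin α) :
    hermiteHe n (2 * Real.cos α * √n) / oscAmplitude n α
      = (Complex.exp ((n * (α - Real.sin α * Real.cos α) : ℝ) * Complex.I) *
          ((√(Real.sin α / Real.pi) : ℝ) * ∫ y : ℝ, (Set.Ioi (-(√n * Real.sin α))).indicator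
        (saddleKernel n (Complex.exp (α * Complex.I))) y)).re := by
  have hn' : (0 : ℝ) < n := by exact_mod_cast hn
  set w₀ := Complex.exp (α * Complex.I) with hw
  have h₀ : w₀ ≠ 0 := Complex.exp_ne_zero _
  have hinv : w₀⁻¹ = Complex.exp (-α * Complex.I) := by
    rw [hw, ← Complex.exp_neg, neg_mul]
  have hX : ((2 * Real.cos α : ℝ) : ℂ) = w₀ + w₀⁻¹ := by
    rw [hinv, hw]
    push_cast
    rw [Complex.two_cos]
  have hI := scaled_hermite_eq_two_mul_re hn (2 * Real.cos α) w₀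
  have him : w₀.im = Real.sin α := Complex.exp_ofReal_mul_I_im α
  simp only [scaled_eq_saddleKernel hn h₀ hX, him] at hI
  have hind : ∀ y : ℝ, (Set.Ioi (-(√n * Real.sin α))).indicator
      (fun y : ℝ => w₀ ^ n * Complex.exp (n * w₀⁻¹ ^ 2 / 2) * saddleKernel n w₀ y) y
      = w₀ ^ n * Complex.exp (n * w₀⁻¹ ^ 2 / 2) * (Set.Ioi (-(√n * Real.sin α))).indicator
        (saddleKernel n w₀) y := fun y => by
    by_cases hy : y ∈ Set.Ioi (-(√n * Real.sin α))
    · rw [Set.indicator_of_mem hy, Set.indicator_of_mem hy]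
    · rw [Set.indicator_of_notMem hy, Set.indicator_of_notMem hy, mul_zero]
  simp only [hind] at hI
  rw [integral_const_mul] at hI
  set J := ∫ y : ℝ, (Set.Ioi (-(√n * Real.sin α))).indicator (saddleKernel n w₀) y
  have hpre : ((√n : ℝ) : ℂ) ^ n * (w₀ ^ n * Complex.exp (n * w₀⁻¹ ^ 2 / 2) * J)
      = (((n : ℝ) ^ ((n : ℝ) / 2) * Real.exp (n * (Real.cos α ^ 2 - 1 / 2)) : ℝ) : ℂ) *
        (Complex.exp ((n * (α - Real.sin α * Real.cos α) : ℝ) * Complex.I) * J) := by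
    have e : w₀⁻¹ ^ 2 = ((2 * Real.cos α ^ 2 - 1 : ℝ) : ℂ)
        - ((2 * Real.sin α * Real.cos α : ℝ) : ℂ) * Complex.I := by
      rw [hinv, ← Complex.exp_nat_mul, ← Real.cos_two_mul, ← Real.sin_two_mul,
        show ((2 : ℕ) : ℂ) * (-α * Complex.I) = ((-(2 * α) : ℝ) : ℂ) * Complex.I by push_cast; ring,
        Complex.exp_mul_I, ← Complex.ofReal_cos, ← Complex.ofReal_sin, Real.cos_neg, Real.sin_neg]
      push_cast
      ring
    rw [e, hw, ← Complex.exp_nat_mul, ← Complex.exp_add, ← sqrt_natCast_pow,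
      Complex.ofReal_mul (√(n : ℝ) ^ n),
      Complex.ofReal_exp, mul_assoc ((√(n : ℝ) ^ n : ℝ) : ℂ), ← mul_assoc (Complex.exp _) _ J,
      ← Complex.exp_add, Complex.ofReal_pow]
    congr 3
    push_cast
    ring
  rw [hpre, Complex.re_ofReal_mul] at hI
  have hassoc : ∀ E : ℂ, (E * ((√(Real.sin α / Real.pi) : ℝ) * J)).re
      = √(Real.sin α / Real.pi) * (E * J).re := fun E => by
    rw [← Complex.re_ofReal_mul]
    congr 1
    ring
  rw [hassoc, div_eq_iff (oscAmplitude_pos hn hs).ne', oscAmplitude]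
  -- The `2` is the one from the two conjugate half lines.
  have hk : √(Real.sin α / Real.pi) * √(2 / Real.sin α) * √(2 * Real.pi) = 2 := by
    rw [← Real.sqrt_mul (by positivity), ← Real.sqrt_mul (by positivity), Real.sqrt_eq_iff_mul_self_eq
      (by positivity) (by positivity)]
    have := Real.pi_pos
    field_simp
  have h2 : √(2 * Real.pi) ≠ 0 := by positivity
  apply mul_left_cancel₀ h2
  rw [hI]
  set R := (Complex.exp ((n * (α - Real.sin α * Real.cos α) : ℝ) * Complex.I) * J).re
  linear_combination (-((n : ℝ) ^ ((n : ℝ) / 2) * Real.exp (n * (Real.cos α ^ 2 - 1 / 2)) * R)) * hk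

/-- The factor `exp(i n (α - sin α cos α))` has no limit, but its modulus is one, so replacing the
integral by its limit costs no more than their distance. -/
theorem tendsto_hermiteHe_small {α : ℝ} (h0 : 0 < α) (h1 : α < Real.pi / 2) :
    Tendsto (fun n : ℕ => hermiteHe n (2 * Real.cos α * √n) / oscAmplitude n α
          - Real.cos (oscPhase n α)) atTop (𝓝 0) := by
  have hs : 0 < Real.sin α := Real.sin_pos_of_pos_of_lt_pi h0 (by linarith [Real.pi_pos])
  have hJ := (tendsto_integral_indicator_saddleKernel h0 h1).const_mul
    ((√(Real.sin α / Real.pi) : ℝ) : ℂ)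
  rw [← mul_assoc, ← Complex.ofReal_mul, ← Real.sqrt_mul (by positivity),
    div_mul_div_cancel₀ Real.pi_pos.ne', div_self hs.ne', Real.sqrt_one, Complex.ofReal_one,
    one_mul] at hJ
  rw [tendsto_iff_norm_sub_tendsto_zero] at hJ
  refine squeeze_zero_norm' ?_ hJ
  filter_upwards [eventually_gt_atTop 0] with n hn
  rw [hermiteHe_div_oscAmplitude hn hs]
  have hcos : Real.cos (oscPhase n α)
      = (Complex.exp ((n * (α - Real.sin α * Real.cos α) : ℝ) * Complex.I) *
          Complex.exp (((α - Real.pi / 2) / 2 : ℝ) * Complex.I)).re := by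
    rw [← Complex.exp_add, ← add_mul, ← Complex.ofReal_add, Complex.exp_ofReal_mul_I_re,
      ← Real.cos_neg, oscPhase]
    congr 1
    ring
  rw [hcos, ← Complex.sub_re, ← mul_sub]
  refine (Complex.abs_re_le_norm _).trans ?_
  rw [norm_mul, Complex.norm_exp_ofReal_mul_I, one_mul]

/-! ### The Airy function as an integral over a vertical line -/

/-- The integrand `exp(w³/3 - u w)` of the Airy integral. -/
noncomputable def airyKernel (u : ℝ) (w : ℂ) : ℂ := Complex.exp (w ^ 3 / 3 - u * w)

theorem differentiable_airyKernel (u : ℝ) : Differentiable ℂ (airyKernel u) := by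
  unfold airyKernel
  fun_prop

theorem norm_airyKernel (u s T : ℝ) :
    ‖airyKernel u (s + T * Complex.I)‖ = Real.exp (s ^ 3 / 3 - s * T ^ 2 - u * s) := by
  have h : ((s : ℂ) + T * Complex.I) ^ 3 / 3 - u * (s + T * Complex.I)
      = ((s ^ 3 / 3 - s * T ^ 2 - u * s : ℝ) : ℂ)
        + ((s ^ 2 * T - T ^ 3 / 3 - u * T : ℝ) : ℂ) * Complex.I := by
    push_cast
    linear_combination (s * T ^ 2 + T ^ 3 / 3 * Complex.I : ℂ) * Complex.I_sq
  rw [airyKernel, Complex.norm_exp, h, Complex.add_re, Complex.ofReal_re, Complex.re_ofReal_mul,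
    Complex.I_re, mul_zero, add_zero]

theorem airyKernel_conj (u : ℝ) (w : ℂ) :
    airyKernel u (starRingEnd ℂ w) = starRingEnd ℂ (airyKernel u w) := by
  simp [airyKernel, ← Complex.exp_conj, map_ofNat (starRingEnd ℂ) 3]

theorem exp_pi_div_three_mul_I :
    Complex.exp ((Real.pi / 3 : ℝ) * Complex.I) = (1 / 2 : ℝ) + (√3 / 2 : ℝ) * Complex.I := by
  rw [Complex.exp_mul_I, ← Complex.ofReal_cos, ← Complex.ofReal_sin, Real.cos_pi_div_three,
    Real.sin_pi_div_three]

theorem airyRayIntegrand_eq (φ u t : ℝ) :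
    airyRayIntegrand φ u t
      = airyKernel u (t * Complex.exp (φ * Complex.I)) * Complex.exp (φ * Complex.I) := rfl

theorem integrableOn_airyRayIntegrand (u : ℝ) :
    IntegrableOn (airyRayIntegrand (Real.pi / 3) u) (Set.Ioi 0) := by
  have hA : 0 < 1 + |u| := by positivity
  refine Integrable.mono' ((exp_neg_integrableOn_Ioi 0 one_pos).const_mul
    (Real.exp (2 / 3 * (1 + |u|) ^ 3))) ?_ ?_
  · refine Continuous.aestronglyMeasurable ?_
    unfold airyRayIntegrand
    fun_prop
  · refine (ae_restrict_iff' measurableSet_Ioi).2 (Eventually.of_forall fun t ht => ?_)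
    have ht : 0 < t := ht
    have e : (t : ℂ) * Complex.exp ((Real.pi / 3 : ℝ) * Complex.I)
        = ((t / 2 : ℝ) : ℂ) + ((t * √3 / 2 : ℝ) : ℂ) * Complex.I := by
      rw [exp_pi_div_three_mul_I]
      push_cast
      ring
    rw [airyRayIntegrand_eq, norm_mul, Complex.norm_exp_ofReal_mul_I, mul_one, e, norm_airyKernel,
      ← Real.exp_add]
    refine Real.exp_le_exp.2 ?_
    have h3 : √3 ^ 2 = (3 : ℝ) := Real.sq_sqrt (by norm_num)
    -- With `A = 1 + |u|` this is the tangent bound `-t³/3 ≤ 2A³/3 - A² t`; as `A² ≥ 1 + 2|u|`, it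
    -- absorbs `-ut/2` and leaves `-t`.
    have htan : 0 ≤ (t - (1 + |u|)) ^ 2 * (t + 2 * (1 + |u|)) := by positivity
    have hu := mul_le_mul_of_nonneg_right (neg_abs_le u) ht.le
    have hu2 : 0 ≤ |u| * t := by positivity
    have hu3 : 0 ≤ |u| ^ 2 * t := by positivity
    have : t / 2 * (t * √3 / 2) ^ 2 = 3 / 8 * t ^ 3 := by
      rw [div_pow, mul_pow, h3]; ring
    rw [this]
    nlinarith

theorem integrable_airyKernel_line (u : ℝ) :
    Integrable (fun τ : ℝ => airyKernel u (1 + τ * Complex.I)) := by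
  refine Integrable.mono' ((integrable_exp_neg_mul_sq one_pos).const_mul (Real.exp (1 / 3 - u)))
    ?_ (Eventually.of_forall fun τ => ?_)
  · exact ((differentiable_airyKernel u).continuous.comp (by fun_prop)).aestronglyMeasurable
  · have := norm_airyKernel u 1 τ
    rw [Complex.ofReal_one] at this
    rw [this, ← Real.exp_add]
    refine Real.exp_le_exp.2 (le_of_eq ?_)
    ring

/-- This closes the contour at height `T`. On the segment `s² ≤ T²/3`, so `s³/3 ≤ sT²/9` and the
exponent is at most `-s(8/9 T² + u) ≤ -T`. -/
theorem norm_primitive_sub_le {u T : ℝ} {F : ℂ → ℂ} (hF : ∀ w, HasDerivAt F (airyKernel u w) w)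
    (hT : T ≤ 8 / 9 * T ^ 2 + u) {b : ℝ} (hb : 1 ≤ b) (hbT : b ^ 2 ≤ T ^ 2 / 3) (hT0 : 0 < T) :
    ‖F (b + T * Complex.I) - F (1 + T * Complex.I)‖ ≤ T * Real.exp (-T) := by
  have hd : ∀ s ∈ Set.Icc (1 : ℝ) b, HasDerivWithinAt (fun s : ℝ => F (s + T * Complex.I))
      (airyKernel u (s + T * Complex.I)) (Set.Icc 1 b) s := fun s _ => by
    have h1 : HasDerivAt (fun s : ℝ => (s : ℂ) + T * Complex.I) 1 s :=
      (Complex.ofRealCLM.hasDerivAt (x := s)).add_const _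
    exact (((hF _).comp s h1).congr_deriv (mul_one _)).hasDerivWithinAt
  have hbound : ∀ s ∈ Set.Icc (1 : ℝ) b, ‖airyKernel u (s + T * Complex.I)‖ ≤ Real.exp (-T) := by
    intro s hs
    rw [norm_airyKernel]
    refine Real.exp_le_exp.2 ?_
    have hs0 : 0 < s := by linarith [hs.1]
    have hs2 : s ^ 2 ≤ T ^ 2 / 3 := le_trans (by nlinarith [hs.1, hs.2]) hbT
    have h1 := mul_le_mul_of_nonneg_left hs2 hs0.le
    have h2 := mul_le_mul_of_nonneg_left hT hs0.le
    nlinarith [hs.1]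
  have h := Convex.norm_image_sub_le_of_norm_hasDerivWithin_le hd hbound (convex_Icc 1 b)
    (Set.left_mem_Icc.2 hb) (Set.right_mem_Icc.2 hb)
  rw [Complex.ofReal_one] at h
  refine h.trans ?_
  rw [mul_comm]
  refine mul_le_mul_of_nonneg_right ?_ (Real.exp_pos _).le
  rw [Real.norm_of_nonneg (by linarith)]
  nlinarith

theorem im_primitive_sub {u : ℝ} {F : ℂ → ℂ} (hF : ∀ w, HasDerivAt F (airyKernel u w) w) :
    (F 1 - F 0).im = 0 := by
  have h1 : ∀ s : ℝ, HasDerivAt (fun s : ℝ => F s) (airyKernel u s) s := fun s =>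
    (hF s).comp_ofReal
  have hk : ∀ s : ℝ, airyKernel u s = ((Real.exp (s ^ 3 / 3 - u * s) : ℝ) : ℂ) := fun s => by
    simp [airyKernel]
  have h2 := intervalIntegral.integral_eq_sub_of_hasDerivAt (a := 0) (b := 1) (fun s _ => h1 s)
    (((differentiable_airyKernel u).continuous.comp Complex.continuous_ofReal).intervalIntegrable _ _)
  simp only [hk, Complex.ofReal_one, Complex.ofReal_zero] at h2
  rw [← h2, intervalIntegral.integral_ofReal, Complex.ofReal_im]

/-- Cauchy's theorem through a primitive `F` of the entire integrand: with `U` the line and `R` the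
ray integral, `R - iU = F 1 - F 0`, as the horizontal gap vanishes at infinity. The right side is
real because the integrand is real on `[0, 1]`. -/
theorem re_integral_airyKernel_line (u : ℝ) :
    (∫ τ in Set.Ioi (0 : ℝ), airyKernel u (1 + τ * Complex.I)).re
      = (∫ t in Set.Ioi (0 : ℝ), airyRayIntegrand (Real.pi / 3) u t).im := by
  obtain ⟨F, hF'⟩ := (differentiable_airyKernel u).isExactOn_univ
  have hF : ∀ w, HasDerivAt F (airyKernel u w) w := fun w => hF' w (Set.mem_univ w)
  set U := ∫ τ in Set.Ioi (0 : ℝ), airyKernel u (1 + τ * Complex.I)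
  set R := ∫ t in Set.Ioi (0 : ℝ), airyRayIntegrand (Real.pi / 3) u t
  set e := Complex.exp ((Real.pi / 3 : ℝ) * Complex.I) with he
  have hT : Tendsto (fun r : ℝ => r * √3 / 2) atTop atTop := by
    have : Tendsto (fun r : ℝ => r * (√3 / 2)) atTop atTop :=
      tendsto_id.atTop_mul_const (by positivity)
    simpa [mul_div_assoc] using this
  have hray : Tendsto (fun r : ℝ => F (r * e) - F 0) atTop (𝓝 R) := by
    refine (intervalIntegral_tendsto_integral_Ioi 0 (integrableOn_airyRayIntegrand u)
      tendsto_id).congr fun r => ?_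
    have hd : ∀ t : ℝ, HasDerivAt (fun t : ℝ => F (t * e)) (airyRayIntegrand (Real.pi / 3) u t) t :=
      fun t => by
        have h : HasDerivAt (fun t : ℝ => (t : ℂ) * e) e t := by
          simpa using (Complex.ofRealCLM.hasDerivAt (x := t)).mul_const e
        exact (hF _).comp t h
    have := intervalIntegral.integral_eq_sub_of_hasDerivAt (a := 0) (b := r) (fun t _ => hd t)
      (Continuous.intervalIntegrable (by unfold airyRayIntegrand; fun_prop) _ _)
    simpa using this
  have hline : Tendsto (fun r : ℝ => F (1 + ((r * √3 / 2 : ℝ) : ℂ) * Complex.I) - F 1) atTop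
      (𝓝 (U * Complex.I)) := by
    refine ((intervalIntegral_tendsto_integral_Ioi 0
      (integrable_airyKernel_line u).integrableOn hT).mul_const Complex.I).congr fun r => ?_
    have hd : ∀ t : ℝ, HasDerivAt (fun t : ℝ => F (1 + t * Complex.I))
        (airyKernel u (1 + t * Complex.I) * Complex.I) t := fun t => (hF _).comp t (by
        simpa using ((Complex.ofRealCLM.hasDerivAt (x := t)).mul_const Complex.I).const_add 1)
    have := intervalIntegral.integral_eq_sub_of_hasDerivAt (a := 0) (b := r * √3 / 2)
      (fun t _ => hd t) (Continuous.intervalIntegrable (by unfold airyKernel; fun_prop) _ _)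
    rw [intervalIntegral.integral_mul_const] at this
    simpa using this
  have hgap : Tendsto (fun r : ℝ => F (r * e) - F (1 + ((r * √3 / 2 : ℝ) : ℂ) * Complex.I)) atTop
      (𝓝 0) := by
    have h0 : Tendsto (fun T : ℝ => T * Real.exp (-T)) atTop (𝓝 0) := by
      simpa using Real.tendsto_pow_mul_exp_neg_atTop_nhds_zero 1
    refine squeeze_zero_norm' ?_ (h0.comp hT)
    -- `r ≥ 2` puts `r/2` to the right of `1`; `T ≥ 9/4 + |u|` yields `8/9 T² ≥ 2T + 2|u|`, hence `T
    -- ≤ 8/9 T² + u`.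
    filter_upwards [eventually_ge_atTop 2, hT.eventually_ge_atTop (9 / 4 + |u|)] with r hr hTr
    have h3 : √3 ^ 2 = (3 : ℝ) := Real.sq_sqrt (by norm_num)
    have hb : (r : ℂ) * e = ((r / 2 : ℝ) : ℂ) + ((r * √3 / 2 : ℝ) : ℂ) * Complex.I := by
      rw [he, exp_pi_div_three_mul_I]
      push_cast
      ring
    rw [hb]
    refine norm_primitive_sub_le hF ?_ (by linarith) (le_of_eq ?_)
      (by linarith [abs_nonneg u])
    · nlinarith [neg_abs_le u, abs_nonneg u]
    · linear_combination (-(r ^ 2 / 12)) * h3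
  have hlim := (hray.sub hline).sub hgap
  have huniq := tendsto_nhds_unique (hlim.congr fun r => (by ring :
    _ = F 1 - F 0)) tendsto_const_nhds
  have him := congrArg Complex.im huniq
  rw [im_primitive_sub hF] at him
  simp at him
  linarith

/-- By conjugation symmetry both sides are twice the imaginary part of the integral over the upper
ray. -/
theorem integral_airyKernel_line (u : ℝ) :
    ∫ τ : ℝ, airyKernel u (1 + τ * Complex.I) = ((2 * Real.pi * airyAi u : ℝ) : ℂ) := by
  set R := ∫ t in Set.Ioi (0 : ℝ), airyRayIntegrand (Real.pi / 3) u t with hR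
  have hconj : ∫ t in Set.Ioi (0 : ℝ), airyRayIntegrand (-(Real.pi / 3)) u t = starRingEnd ℂ R := by
    rw [hR, ← integral_conj]
    congr 1
    funext t
    rw [airyRayIntegrand_eq, airyRayIntegrand_eq, map_mul, ← airyKernel_conj, map_mul,
      ← Complex.exp_conj]
    simp [map_ofNat (starRingEnd ℂ) 3]
  have hA : airyC u = ((R.im / Real.pi : ℝ) : ℂ) := by
    rw [airyC, hconj, Complex.sub_conj]
    have : (Real.pi : ℂ) ≠ 0 := Complex.ofReal_ne_zero.2 Real.pi_ne_zero
    push_cast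
    field_simp
    rfl
  have hAi : airyAi u = R.im / Real.pi := by rw [airyAi, hA, Complex.ofReal_re]
  rw [hAi, ← integral_add_compl (measurableSet_Ioi (a := (0 : ℝ))) (integrable_airyKernel_line u),
    Set.compl_Ioi, ← neg_zero, ← integral_comp_neg_Ioi, neg_zero]
  have h2 : ∫ τ in Set.Ioi (0 : ℝ), airyKernel u (1 + ((-τ : ℝ) : ℂ) * Complex.I)
      = starRingEnd ℂ (∫ τ in Set.Ioi (0 : ℝ), airyKernel u (1 + τ * Complex.I)) := by
    rw [← integral_conj]
    congr 1
    funext τ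
    rw [← airyKernel_conj]
    simp
  rw [h2, Complex.add_conj, re_integral_airyKernel_line, ← hR]
  congr 1
  have := Real.pi_pos
  field_simp

/-! ### The edge -/

/-- The integrand of the scaled representation near the double saddle point `1`, on the scale
`h = n^{-1/3}` and normalised by its value there. -/
noncomputable def edgeKernel (n : ℕ) (h u : ℝ) (t : ℂ) : ℂ :=
  (1 + h * t) ^ n * Complex.exp (n * (-(h * t) + (h * t) ^ 2 / 2) - u * t)

/-- With `n h³ = 1` the offset `h² u` of `X` from `2` couples to `t` exactly through `-u t`; the
remaining terms in `u` are constant in `t`. -/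
theorem scaled_eq_edgeKernel {n : ℕ} {h : ℝ} (hh : 0 < h) (hnh : n * h ^ 3 = 1) (u : ℝ) (t : ℂ) :
    (1 + h * t) ^ n * Complex.exp (n * (1 + h * t - ((2 + h ^ 2 * u : ℝ) : ℂ)) ^ 2 / 2)
      = ((Real.exp (n / 2 + u / h + h * u ^ 2 / 2) : ℝ) : ℂ) * edgeKernel n h u t := by
  rw [edgeKernel, mul_left_comm, Complex.ofReal_exp, ← Complex.exp_add]
  congr 2
  have hc : (h : ℂ) ≠ 0 := Complex.ofReal_ne_zero.2 hh.ne'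
  have hn : (n : ℂ) * h ^ 3 = 1 := by exact_mod_cast hnh
  push_cast
  field_simp
  linear_combination (2 * u - 2 * h * t * u + h ^ 2 * u ^ 2 : ℂ) * hn

theorem norm_edgeKernel_le {n : ℕ} {h : ℝ} (hh : 0 < h) (hh2 : h ≤ 1 / 2) (hnh : n * h ^ 3 = 1)
    (u τ : ℝ) :
    ‖edgeKernel n h u (1 + τ * Complex.I)‖
      ≤ Real.exp (1 - u) * Real.exp (-(1 / 4) * τ ^ 2) := by
  have hre : ((n : ℂ) * (-(h * (1 + τ * Complex.I)) + (h * (1 + τ * Complex.I)) ^ 2 / 2)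
      - u * (1 + τ * Complex.I)) = ((n * (-h + h ^ 2 * (1 - τ ^ 2) / 2) - u : ℝ) : ℂ)
        + ((n * (-(h * τ) + h ^ 2 * τ) - u * τ : ℝ) : ℂ) * Complex.I := by
    push_cast
    linear_combination (n * h ^ 2 * τ ^ 2 / 2 : ℂ) * Complex.I_sq
  have hlog : 1 + h ≤ Real.exp (h - h ^ 2 / 2 + h ^ 3) := by
    have hb := norm_log_one_add_sub_le (w := (h : ℂ))
      (by rwa [Complex.norm_real, Real.norm_of_nonneg hh.le])
    have e : Complex.log (1 + h) - h + (h : ℂ) ^ 2 / 2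
        = ((Real.log (1 + h) - h + h ^ 2 / 2 : ℝ) : ℂ) := by
      push_cast
      rw [Complex.ofReal_log (by positivity)]
      push_cast
      rfl
    rw [e, Complex.norm_real, Complex.norm_real, Real.norm_of_nonneg hh.le] at hb
    have h1 := (le_abs_self _).trans hb
    rw [← Real.log_le_iff_le_exp (by positivity)]
    linarith
  set q := τ ^ 2 * h ^ 2 / (1 + h) ^ 2 with hq
  have hnorm : ‖1 + (h : ℂ) * (1 + τ * Complex.I)‖
      ≤ Real.exp (h - h ^ 2 / 2 + h ^ 3 + q / 2) := by
    refine le_of_sq_le_sq ?_ (Real.exp_pos _).le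
    have e : 1 + (h : ℂ) * (1 + τ * Complex.I) = ((1 + h : ℝ) : ℂ) + ((h * τ : ℝ) : ℂ) * Complex.I := by
      push_cast
      ring
    rw [e, ← Complex.normSq_eq_norm_sq, Complex.normSq_add_mul_I, Real.exp_add, mul_pow (Real.exp _),
      ← Real.exp_nat_mul (q / 2)]
    calc (1 + h) ^ 2 + (h * τ) ^ 2 = (1 + h) ^ 2 * (q + 1) := by
          rw [hq]; field_simp; ring
      _ ≤ Real.exp (h - h ^ 2 / 2 + h ^ 3) ^ 2 * Real.exp ((2 : ℕ) * (q / 2)) := by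
          gcongr
          refine (Real.add_one_le_exp q).trans (le_of_eq ?_)
          congr 1
          push_cast
          ring
  rw [edgeKernel, norm_mul, norm_pow, Complex.norm_exp, hre, Complex.add_re, Complex.ofReal_re,
    Complex.re_ofReal_mul, Complex.I_re, mul_zero, add_zero]
  -- The line has abscissa `1 + h`, not `1`, to gain this factor `1 - h/2`: the leading quadratic
  -- terms cancel, and the gain `n h³ τ²/4 = τ²/4` is the Gaussian decay.
  have hqle : q ≤ τ ^ 2 * h ^ 2 * (1 - h / 2) := by
    rw [hq, div_le_iff₀ (by positivity), mul_assoc]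
    refine le_mul_of_one_le_right (by positivity) ?_
    nlinarith [pow_pos hh 2, pow_pos hh 3]
  calc _ ≤ Real.exp (h - h ^ 2 / 2 + h ^ 3 + q / 2) ^ n *
        Real.exp (n * (-h + h ^ 2 * (1 - τ ^ 2) / 2) - u) := by gcongr
    _ = Real.exp (n * (h ^ 3 + q / 2 - h ^ 2 * τ ^ 2 / 2) - u) := by
      rw [← Real.exp_nat_mul, ← Real.exp_add]
      congr 1
      ring
    _ ≤ _ := by
      rw [← Real.exp_add]
      refine Real.exp_le_exp.2 ?_
      have h1 := mul_le_mul_of_nonneg_left hqle (Nat.cast_nonneg (α := ℝ) n)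
      have h2 : (n : ℝ) * (τ ^ 2 * h ^ 2 * (1 - h / 2))
          = n * (τ ^ 2 * h ^ 2) - τ ^ 2 / 2 := by
        linear_combination (-(τ ^ 2 / 2)) * hnh
      rw [h2] at h1
      linarith

/-- The scale `n^{-1/3}` of the edge regime. -/
noncomputable def edgeScale (n : ℕ) : ℝ := (n : ℝ) ^ (-(1 / 3) : ℝ)

theorem edgeScale_pos {n : ℕ} (hn : 0 < n) : 0 < edgeScale n := by
  have hn' : (0 : ℝ) < n := by exact_mod_cast hn
  exact Real.rpow_pos_of_pos hn' _

theorem natCast_mul_edgeScale_pow {n : ℕ} (hn : 0 < n) : n * edgeScale n ^ 3 = 1 := by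
  have hn' : (0 : ℝ) < n := by exact_mod_cast hn
  rw [edgeScale, ← Real.rpow_natCast, ← Real.rpow_mul hn'.le]
  norm_num
  rw [Real.rpow_neg_one, mul_inv_cancel₀ hn'.ne']

theorem tendsto_edgeScale : Tendsto edgeScale atTop (𝓝 0) :=
  (tendsto_rpow_neg_atTop (by norm_num : (0 : ℝ) < 1 / 3)).comp tendsto_natCast_atTop_atTop

/-- The kernel cancels the linear and quadratic terms of `n log(1 + ht)`; the cubic one is `n h³
t³/3 = t³/3`, and the error is of order `h`. -/
theorem tendsto_edgeKernel (u : ℝ) (t : ℂ) :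
    Tendsto (fun n : ℕ => edgeKernel n (edgeScale n) u t) atTop (𝓝 (airyKernel u t)) := by
  have hlim : Tendsto (fun n : ℕ => edgeScale n * ‖t‖) atTop (𝓝 0) := by
    simpa using tendsto_edgeScale.mul_const ‖t‖
  have hev : ∀ᶠ n : ℕ in atTop, 0 < n ∧ edgeScale n * ‖t‖ ≤ 1 / 2 :=
    (eventually_gt_atTop 0).and (hlim.eventually_le_const (by norm_num))
  have hnorm : ∀ n : ℕ, 0 < n → ‖(edgeScale n : ℂ) * t‖ = edgeScale n * ‖t‖ := fun n hn => by
    rw [norm_mul, Complex.norm_real, Real.norm_of_nonneg (edgeScale_pos hn).le]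
  have hmain : Tendsto (fun n : ℕ => (n : ℂ) * (Complex.log (1 + edgeScale n * t) - edgeScale n * t
      + (edgeScale n * t) ^ 2 / 2 - (edgeScale n * t) ^ 3 / 3)) atTop (𝓝 0) := by
    refine squeeze_zero_norm' (a := fun n : ℕ => ‖t‖ ^ 3 * (edgeScale n * ‖t‖)) ?_
      (by simpa using hlim.const_mul (‖t‖ ^ 3))
    filter_upwards [hev] with n hn
    have hb := norm_log_one_add_sub_le' ((hnorm n hn.1).trans_le hn.2)
    rw [hnorm n hn.1] at hb
    rw [norm_mul, Complex.norm_natCast]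
    calc _ ≤ (n : ℝ) * (edgeScale n * ‖t‖) ^ 4 := by gcongr
      _ = _ := by
        linear_combination (‖t‖ ^ 4 * edgeScale n) * natCast_mul_edgeScale_pow hn.1
  have hexp := (Complex.continuous_exp.tendsto _).comp (hmain.add_const (t ^ 3 / 3 - u * t))
  rw [zero_add] at hexp
  refine hexp.congr' ?_
  filter_upwards [hev] with n hn
  have h1 : (1 + edgeScale n * t : ℂ) ≠ 0 := by
    intro h
    have h2 : ‖(edgeScale n * t : ℂ)‖ = 1 := by
      rw [eq_neg_of_add_eq_zero_right h]; simp
    rw [hnorm n hn.1] at h2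
    linarith [hn.2]
  rw [edgeKernel, Function.comp_apply]
  conv_rhs => rw [← Complex.exp_log h1, ← Complex.exp_nat_mul, ← Complex.exp_add]
  congr 1
  have hc : (n : ℂ) * edgeScale n ^ 3 = 1 := by exact_mod_cast natCast_mul_edgeScale_pow hn.1
  linear_combination (-(t ^ 3 / 3)) * hc

theorem tendsto_integral_edgeKernel (u : ℝ) :
    Tendsto (fun n : ℕ => ∫ τ : ℝ, edgeKernel n (edgeScale n) u (1 + τ * Complex.I)) atTop
      (𝓝 ((2 * Real.pi * airyAi u : ℝ) : ℂ)) := by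
  rw [← integral_airyKernel_line]
  refine tendsto_integral_filter_of_dominated_convergence
    (fun τ => Real.exp (1 - u) * Real.exp (-(1 / 4) * τ ^ 2)) ?_ ?_
    ((integrable_exp_neg_mul_sq (by norm_num)).const_mul _) ?_
  · refine Eventually.of_forall fun n => Continuous.aestronglyMeasurable ?_
    unfold edgeKernel
    fun_prop
  · filter_upwards [eventually_gt_atTop 0,
      tendsto_edgeScale.eventually_le_const (by norm_num : (0 : ℝ) < 1 / 2)] with n hn hn2
    exact Eventually.of_forall fun τ =>
      norm_edgeKernel_le (edgeScale_pos hn) hn2 (natCast_mul_edgeScale_pow hn) u τ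
  · exact Eventually.of_forall fun τ => tendsto_edgeKernel u _

/-- The factor `n^{1/6}` is the Jacobian of `y = h√n τ`, and `exp(h u²/2)`, the only part of the
prefactor not in `edgeFactor`, tends to one. -/
theorem hermiteHe_div_edgeFactor {n : ℕ} (hn : 0 < n) (u : ℝ) :
    hermiteHe n (2 * √n + (n : ℝ) ^ (-(1 / 6) : ℝ) * u) / edgeFactor n u
      = Real.exp (edgeScale n * u ^ 2 / 2) *
        (∫ τ : ℝ, edgeKernel n (edgeScale n) u (1 + τ * Complex.I)).re / (2 * Real.pi) := by
  have hn' : (0 : ℝ) < n := by exact_mod_cast hn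
  set h := edgeScale n with hdef
  have hh : 0 < h := edgeScale_pos hn
  have hnh : n * h ^ 3 = 1 := natCast_mul_edgeScale_pow hn
  have hroot : h * √n = (n : ℝ) ^ (1 / 6 : ℝ) := by
    rw [hdef, edgeScale, Real.sqrt_eq_rpow, ← Real.rpow_add hn']
    norm_num
  have hinv : u / h = u * (n : ℝ) ^ (1 / 3 : ℝ) := by
    rw [hdef, edgeScale, Real.rpow_neg hn'.le, div_inv_eq_mul]
  have hx : 2 * √n + (n : ℝ) ^ (-(1 / 6) : ℝ) * u = (2 + h ^ 2 * u) * √n := by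
    have : (n : ℝ) ^ (-(1 / 6) : ℝ) = h ^ 2 * √n := by
      rw [hdef, edgeScale, Real.sqrt_eq_rpow, ← Real.rpow_natCast, ← Real.rpow_mul hn'.le,
        ← Real.rpow_add hn']
      norm_num
    rw [this]
    ring
  set a := h * √n with ha
  have ha0 : 0 < a := by positivity
  have hI := integral_scaled_hermite hn (2 + h ^ 2 * u) ((1 + h : ℝ) : ℂ)
  rw [← hx] at hI
  set g : ℝ → ℂ := fun y => (((1 + h : ℝ) : ℂ) + y / √n * Complex.I) ^ n *
    Complex.exp (n * (((1 + h : ℝ) : ℂ) + y / √n * Complex.I - ((2 + h ^ 2 * u : ℝ) : ℂ)) ^ 2 / 2)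
    with hg
  have hsub : ∫ y, g y = (a : ℂ) * ∫ τ : ℝ, g (a * τ) := by
    rw [Measure.integral_comp_mul_left, abs_of_pos (inv_pos.2 ha0), Complex.real_smul, ← mul_assoc,
      ← Complex.ofReal_mul, mul_inv_cancel₀ ha0.ne', Complex.ofReal_one, one_mul]
  have hgk : ∀ τ : ℝ, g (a * τ) = ((Real.exp (n / 2 + u / h + h * u ^ 2 / 2) : ℝ) : ℂ) *
      edgeKernel n h u (1 + τ * Complex.I) := fun τ => by
    rw [← scaled_eq_edgeKernel hh hnh, hg]
    have hs := ofReal_sqrt_natCast_ne_zero hn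
    have e : ((1 + h : ℝ) : ℂ) + ((a * τ : ℝ) : ℂ) / √n * Complex.I
        = 1 + h * (1 + τ * Complex.I) := by
      rw [ha]
      push_cast
      field_simp
      ring
    simp only [e]
  rw [hsub] at hI
  simp only [hgk] at hI
  rw [integral_const_mul] at hI
  set J := ∫ τ : ℝ, edgeKernel n h u (1 + τ * Complex.I)
  have hI' := congrArg Complex.re hI
  rw [← Complex.ofReal_mul, Complex.ofReal_re, ← Complex.ofReal_pow, Complex.re_ofReal_mul,
    Complex.re_ofReal_mul, Complex.re_ofReal_mul, sqrt_natCast_pow, hroot, hinv, Real.exp_add,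
    Real.exp_add] at hI'
  have h2 : (0 : ℝ) < √(2 * Real.pi) := by positivity
  have h3 : √(2 * Real.pi) ^ 2 = 2 * Real.pi := Real.sq_sqrt (by positivity)
  rw [edgeFactor, div_eq_div_iff (by positivity) (by positivity)]
  linear_combination √(2 * Real.pi) * hI'
    - hermiteHe n (2 * √n + (n : ℝ) ^ (-(1 / 6) : ℝ) * u) * h3

theorem tendsto_hermiteHe_edge (u : ℝ) :
    Tendsto (fun n : ℕ => hermiteHe n (2 * √n + (n : ℝ) ^ (-(1 / 6) : ℝ) * u) / edgeFactor n u)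
      atTop (𝓝 (airyAi u)) := by
  have h1 : Tendsto (fun n : ℕ => Real.exp (edgeScale n * u ^ 2 / 2)) atTop (𝓝 1) := by
    have := (Real.continuous_exp.tendsto _).comp
      ((tendsto_edgeScale.mul_const (u ^ 2)).div_const 2)
    simpa [Function.comp_def] using this
  have h2 := (Complex.continuous_re.tendsto _).comp (tendsto_integral_edgeKernel u)
  have h3 := (h1.mul h2).div_const (2 * Real.pi)
  rw [Complex.ofReal_re, one_mul, mul_div_cancel_left₀ _ (by positivity)] at h3
  refine h3.congr' ?_
  filter_upwards [eventually_gt_atTop 0] with n hn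
  rw [hermiteHe_div_edgeFactor hn]
  rfl

/-! ### The three regimes -/

theorem tendsto_div_mul_of_tendsto_sub {ι : Type*} {l : Filter ι} {f A C : ι → ℝ} {S : Set ι}
    {δ : ℝ} (hδ : 0 < δ) (hS : ∀ n ∈ S, δ ≤ |C n|)
    (h : Tendsto (fun n => f n / A n - C n) l (𝓝 0)) :
    Tendsto (fun n => f n / (A n * C n)) (l ⊓ 𝓟 S) (𝓝 1) := by
  refine (tendsto_div_mul_one hδ (h.mono_left inf_le_left)
    (eventually_inf_principal.2 (Eventually.of_forall hS))).congr fun n => ?_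
  rw [div_div]

theorem oscPhaseArccos_eq {a : ℝ} (n : ℕ) (h0 : 0 < a) (h1 : a < 1) :
    oscPhaseArccos n a = oscPhase n (Real.arccos a) := by
  rw [oscPhaseArccos, oscPhase, Real.sin_arccos, Real.cos_arccos (by linarith) h1.le]
  ring

theorem oscAmplitudeArccos_eq {a : ℝ} (n : ℕ) (h0 : 0 < a) (h1 : a < 1) :
    oscAmplitudeArccos n a = oscAmplitude n (Real.arccos a) := by
  have h : 0 ≤ 1 - a ^ 2 := by nlinarith
  rw [oscAmplitudeArccos, oscAmplitude, Real.sin_arccos, Real.cos_arccos (by linarith) h1.le,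
    Real.sqrt_div (by norm_num), Real.sqrt_eq_rpow (√(1 - a ^ 2)), Real.sqrt_eq_rpow (1 - a ^ 2),
    ← Real.rpow_mul h]
  norm_num

theorem theorem3p3 :
    -- small `x`, in terms of `a`
    (∀ a : ℝ, 0 < a → a < 1 →
      Tendsto (fun n : ℕ => hermiteHe n (2 * a * Real.sqrt n) / oscAmplitudeArccos n a
          - Real.cos (oscPhaseArccos n a)) atTop (𝓝 0) ∧
      ∀ δ : ℝ, 0 < δ →
        Tendsto (fun n : ℕ => hermiteHe n (2 * a * Real.sqrt n) /
            (oscAmplitudeArccos n a * Real.cos (oscPhaseArccos n a)))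
          (atTop ⊓ 𝓟 {n : ℕ | δ ≤ |Real.cos (oscPhaseArccos n a)|}) (𝓝 1)) ∧
    -- small `x`, in terms of `α`
    (∀ α : ℝ, 0 < α → α < Real.pi / 2 →
      Tendsto (fun n : ℕ => hermiteHe n (2 * Real.cos α * Real.sqrt n) / oscAmplitude n α
          - Real.cos (oscPhase n α)) atTop (𝓝 0) ∧
      ∀ δ : ℝ, 0 < δ →
        Tendsto (fun n : ℕ => hermiteHe n (2 * Real.cos α * Real.sqrt n) /
            (oscAmplitude n α * Real.cos (oscPhase n α)))
          (atTop ⊓ 𝓟 {n : ℕ | δ ≤ |Real.cos (oscPhase n α)|}) (𝓝 1)) ∧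
    -- large `x`
    (∀ a γ : ℝ, 1 < a → 0 ≤ γ → a = Real.cosh γ →
      Tendsto (fun n : ℕ => hermiteHe n (2 * a * Real.sqrt n) / largeApprox n γ) atTop (𝓝 1)) ∧
    -- the edge
    (∀ u : ℝ,
      Tendsto (fun n : ℕ => hermiteHe n (2 * Real.sqrt n + (n : ℝ) ^ (-(1 / 6) : ℝ) * u) /
          edgeFactor n u) atTop (𝓝 (airyAi u)) ∧
      (airyAi u ≠ 0 →
        Tendsto (fun n : ℕ => hermiteHe n (2 * Real.sqrt n + (n : ℝ) ^ (-(1 / 6) : ℝ) * u) /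
          (edgeFactor n u * airyAi u)) atTop (𝓝 1))) := by
  refine ⟨fun a h0 h1 => ?_, fun α h0 h1 => ?_, fun a γ h1 h2 h3 => ?_, fun u => ?_⟩
  · have h := tendsto_hermiteHe_small (Real.arccos_pos.2 h1) (Real.arccos_lt_pi_div_two.2 h0)
    simp only [Real.cos_arccos (by linarith : -1 ≤ a) h1.le, ← oscPhaseArccos_eq _ h0 h1,
      ← oscAmplitudeArccos_eq _ h0 h1] at h
    exact ⟨h, fun δ hδ => tendsto_div_mul_of_tendsto_sub hδ (fun _ hn => hn) h⟩
  · have h := tendsto_hermiteHe_small h0 h1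
    exact ⟨h, fun δ hδ => tendsto_div_mul_of_tendsto_sub hδ (fun _ hn => hn) h⟩
  · subst h3
    refine tendsto_hermiteHe_large (lt_of_le_of_ne h2 fun h => ?_)
    rw [← h, Real.cosh_zero] at h1
    exact lt_irrefl _ h1
  · have h := tendsto_hermiteHe_edge u
    refine ⟨h, fun hu => ?_⟩
    have h' := h.div_const (airyAi u)
    rw [div_self hu] at h'
    simpa only [div_div] using h'
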